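/- Let $C$ be a commutative $\mathbb{C}$-algebra and let $B$ be an Azumaya algebra over $C$. For $b\in B$ and $t\in C$ say that $b$ has (reduced) trace $t$, written $\mathrm{tr}(b)=t$, if there are an étale cover $\{C\to D_j\}_{j=1}^r$ (each $C\to D_j$ is étale and $\prod_j D_j$ is faithfully flat over $C$), positive integers $n_j$ and isomorphisms of $D_j$-algebras $\varphi_j\colon D_j\otimes_C B\to M_{n_j}(D_j)$ such that the matrix trace of $\varphi_j(1\otimes b)$ is the image of $t$ in $D_j$ for every $j$. Let $\alpha=(d_1,\dots,d_k)$ be a tuple of natural numbers, and suppose that $B$ is of dimension vector $\alpha$, i.e. $B$ is equipped with idempotents $e_1,\dots,e_k\in B$ such that $e_ie_j=0$ for $i\neq j$, $\sum_i e_i=1$ and $\mathrm{tr}(e_i)=d_i$ for all $i$. Let $\mathrm{Br}(C)$ be the Brauer group of $C$: its elements are the classes of Azumaya algebras over $C$, where $A\sim A'$ if $A\otimes_C\mathrm{End}_C(P)\cong A'\otimes_C\mathrm{End}_C(Q)$ as $C$-algebras for some finitely generated projective faithful $C$-modules $P,Q$, and the product is induced by $\otimes_C$. The period of $B$ is the order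 of $[B]$ in $\mathrm{Br}(C)$. Then the period of $B$ divides $\gcd(d_1,\dots,d_k)$. In particular, if $\gcd(d_1,\dots,d_k)=1$, then $[B]=1$ in $\mathrm{Br}(C)$. (If all $d_i$ are zero, in particular if $k=0$, the gcd is $0$ and the divisibility is vacuous; otherwise it includes that the period is finite.) -/

import Mathlib

open scoped TensorProduct

universe u

namespace Azumaya

/-! ### Closure properties of Azumaya algebras -/

section Closure

variable {C : Type u} [CommRing C]

theorem eq_zero_of_forall_dual {P : Type u} [AddCommGroup P] [Module C P] [Module.Projective C P]
    (p : P) (h : ∀ f : Module.Dual C P, f p = 0) : p = 0 := by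
  obtain ⟨s, hs⟩ := Module.Projective.out (R := C) (P := P)
  have h0 : s p = 0 := by
    ext q
    exact h ((Finsupp.lapply (R := C) q).comp s)
  rw [← hs p, h0, map_zero]

theorem faithfulSMul_tensor {P Q : Type u} [AddCommGroup P] [Module C P] [Module.Projective C P]
    [FaithfulSMul C P] [AddCommGroup Q] [Module C Q] [FaithfulSMul C Q] :
    FaithfulSMul C (P ⊗[C] Q) := by
  refine ⟨fun {x y} hxy => ?_⟩
  rw [← sub_eq_zero]
  have key : ∀ p : P, (x - y) • p = 0 := by
    intro p
    refine eq_zero_of_forall_dual (C := C) _ fun f => ?_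
    refine FaithfulSMul.eq_of_smul_eq_smul (α := Q) fun q => ?_
    have h1 := congrArg (TensorProduct.lid C Q ∘ LinearMap.rTensor Q f) (hxy (p ⊗ₜ[C] q))
    simp only [Function.comp_apply, map_smul, LinearMap.rTensor_tmul, TensorProduct.lid_tmul] at h1
    rw [map_smul, zero_smul, smul_eq_mul, mul_smul, sub_smul, h1, sub_self]
  exact FaithfulSMul.eq_of_smul_eq_smul (α := P) fun p => by rw [key p, zero_smul]

theorem exists_retract (P : Type u) [AddCommGroup P] [Module C P] [Module.Projective C P]
    [Module.Finite C P] : ∃ (n : ℕ) (s : P →ₗ[C] (Fin n → C)) (r : (Fin n → C) →ₗ[C] P),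
      r ∘ₗ s = LinearMap.id := by
  obtain ⟨n, r, s, -, -, h⟩ := Module.Finite.exists_comp_eq_id_of_projective C P
  exact ⟨n, s, r, h⟩

/-- The map `f ↦ s ∘ f ∘ r` on endomorphisms. -/
def sandwich {P F : Type u} [AddCommGroup P] [Module C P] [AddCommGroup F] [Module C F]
    (s : P →ₗ[C] F) (r : F →ₗ[C] P) : Module.End C P →ₗ[C] Module.End C F where
  toFun f := s ∘ₗ f ∘ₗ r
  map_add' f g := by ext; simp
  map_smul' c f := by ext; simp

theorem sandwich_apply {P F : Type u} [AddCommGroup P] [Module C P] [AddCommGroup F] [Module C F]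
    (s : P →ₗ[C] F) (r : F →ₗ[C] P) (f : Module.End C P) (x : F) :
    sandwich s r f x = s (f (r x)) := rfl

theorem endTensorEnd_tmul {P Q : Type u} [AddCommGroup P] [Module C P] [AddCommGroup Q]
    [Module C Q] (f : Module.End C P) (g : Module.End C Q) (p : P) (q : Q) :
    (Module.endTensorEndAlgHom :
      Module.End C P ⊗[C] Module.End C Q →ₐ[C] Module.End C (P ⊗[C] Q)) (f ⊗ₜ g) (p ⊗ₜ q) =
      f p ⊗ₜ g q := rfl

/-- `End P ⊗ End Q → End (P ⊗ Q)` is bijective for finitely generated projective modules. -/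
theorem bijective_endTensorEnd (P Q : Type u) [AddCommGroup P] [Module C P] [Module.Projective C P]
    [Module.Finite C P] [AddCommGroup Q] [Module C Q] [Module.Projective C Q] [Module.Finite C Q] :
    Function.Bijective (Module.endTensorEndAlgHom :
      Module.End C P ⊗[C] Module.End C Q →ₐ[C] Module.End C (P ⊗[C] Q)) := by
  obtain ⟨n, s, r, hrs⟩ := exists_retract (C := C) P
  obtain ⟨m, t, v, hvt⟩ := exists_retract (C := C) Q
  let F := Fin n → C
  let G := Fin m → C
  let up1 : Module.End C P →ₗ[C] Module.End C F := sandwich s r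
  let up2 : Module.End C Q →ₗ[C] Module.End C G := sandwich t v
  let dn1 : Module.End C F →ₗ[C] Module.End C P := sandwich r s
  let dn2 : Module.End C G →ₗ[C] Module.End C Q := sandwich v t
  have hr : ∀ p, r (s p) = p := fun p => LinearMap.congr_fun hrs p
  have hv : ∀ q, v (t q) = q := fun q => LinearMap.congr_fun hvt q
  have hd1 : dn1 ∘ₗ up1 = LinearMap.id := by
    ext f p; simp [dn1, up1, hr, sandwich_apply]
  have hd2 : dn2 ∘ₗ up2 = LinearMap.id := by
    ext f p; simp [dn2, up2, hv, sandwich_apply]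
  have hup : ∀ x : Module.End C P ⊗[C] Module.End C Q,
      homTensorHomEquiv C F G F G (TensorProduct.map up1 up2 x) =
        TensorProduct.map s t ∘ₗ (Module.endTensorEndAlgHom (S := C) (A := C) x) ∘ₗ
          TensorProduct.map r v := by
    intro x
    induction x with
    | zero => simp
    | add x y hx hy => simp only [map_add, hx, hy, LinearMap.add_comp, LinearMap.comp_add]
    | tmul f g =>
      rw [homTensorHomEquiv_apply]
      ext i j
      simp [up1, up2, sandwich_apply, endTensorEnd_tmul]
  have hdn : ∀ y : Module.End C F ⊗[C] Module.End C G,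
      Module.endTensorEndAlgHom (S := C) (A := C) (TensorProduct.map dn1 dn2 y) =
        TensorProduct.map r v ∘ₗ homTensorHomEquiv C F G F G y ∘ₗ TensorProduct.map s t := by
    intro x
    induction x with
    | zero => simp
    | add x y hx hy => simp only [map_add, hx, hy, LinearMap.add_comp, LinearMap.comp_add]
    | tmul f g =>
      rw [homTensorHomEquiv_apply]
      ext i j
      simp [dn1, dn2, sandwich_apply, endTensorEnd_tmul]
  constructor
  · rw [injective_iff_map_eq_zero]
    intro x hx
    have h1 := hup x
    rw [hx] at h1
    have h2 : TensorProduct.map up1 up2 x = 0 := by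
      apply (homTensorHomEquiv C F G F G).injective
      rw [h1]; ext; simp
    have h3 := congrArg (TensorProduct.map dn1 dn2) h2
    rw [← LinearMap.comp_apply, ← TensorProduct.map_comp, hd1, hd2, TensorProduct.map_id,
      map_zero] at h3
    exact h3
  · intro f
    refine ⟨TensorProduct.map dn1 dn2 ((homTensorHomEquiv C F G F G).symm
      (TensorProduct.map s t ∘ₗ f ∘ₗ TensorProduct.map r v)), ?_⟩
    rw [hdn, LinearEquiv.apply_symm_apply]
    have h1 : TensorProduct.map r v ∘ₗ TensorProduct.map s t = LinearMap.id := by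
      rw [← TensorProduct.map_comp, hrs, hvt, TensorProduct.map_id]
    have h2 : ∀ z, TensorProduct.map r v (TensorProduct.map s t z) = z :=
      fun z => LinearMap.congr_fun h1 z
    refine LinearMap.ext fun z => ?_
    simp only [LinearMap.comp_apply, h2]

/-- `End P ⊗ End Q ≃ End (P ⊗ Q)` for finitely generated projective modules. -/
noncomputable def endTensorEquiv (P Q : Type u) [AddCommGroup P] [Module C P]
    [Module.Projective C P] [Module.Finite C P] [AddCommGroup Q] [Module C Q]
    [Module.Projective C Q] [Module.Finite C Q] :
    Module.End C P ⊗[C] Module.End C Q ≃ₐ[C] Module.End C (P ⊗[C] Q) :=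
  AlgEquiv.ofBijective _ (bijective_endTensorEnd P Q)

theorem isAzumaya_tensor (A B : Type u) [Ring A] [Algebra C A] [Ring B] [Algebra C B]
    [IsAzumaya C A] [IsAzumaya C B] : IsAzumaya C (A ⊗[C] B) :=
  { toProjective := inferInstance
    toFaithfulSMul := faithfulSMul_tensor
    toFinite := inferInstance
    bij := by
      let E : (A ⊗[C] Aᵐᵒᵖ) ⊗[C] (B ⊗[C] Bᵐᵒᵖ) ≃ₐ[C] (A ⊗[C] B) ⊗[C] (A ⊗[C] B)ᵐᵒᵖ :=
        (Algebra.TensorProduct.tensorTensorTensorComm C C C C A Aᵐᵒᵖ B Bᵐᵒᵖ).trans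
          (Algebra.TensorProduct.congr AlgEquiv.refl (Algebra.TensorProduct.opAlgEquiv C C A B))
      let G : (A ⊗[C] Aᵐᵒᵖ) ⊗[C] (B ⊗[C] Bᵐᵒᵖ) ≃ₐ[C] Module.End C (A ⊗[C] B) :=
        (Algebra.TensorProduct.congr
          (AlgEquiv.ofBijective (AlgHom.mulLeftRight C A) IsAzumaya.bij)
          (AlgEquiv.ofBijective (AlgHom.mulLeftRight C B) IsAzumaya.bij)).trans
          (endTensorEquiv A B)
      have h : (AlgHom.mulLeftRight C (A ⊗[C] B)).comp E.toAlgHom = G.toAlgHom := by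
        have hE : ∀ (a : A) (a' : Aᵐᵒᵖ) (b : B) (b' : Bᵐᵒᵖ), E ((a ⊗ₜ a') ⊗ₜ (b ⊗ₜ b')) =
            (a ⊗ₜ b) ⊗ₜ MulOpposite.op (a'.unop ⊗ₜ b'.unop) := fun _ _ _ _ => rfl
        have hG : ∀ (a : A) (a' : Aᵐᵒᵖ) (b : B) (b' : Bᵐᵒᵖ) (x : A) (y : B),
            G ((a ⊗ₜ a') ⊗ₜ (b ⊗ₜ b')) (x ⊗ₜ y) =
              AlgHom.mulLeftRight C A (a ⊗ₜ a') x ⊗ₜ AlgHom.mulLeftRight C B (b ⊗ₜ b') y :=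
          fun _ _ _ _ _ _ => rfl
        refine AlgHom.toLinearMap_injective ?_
        ext a a' b b' x y
        simp only [TensorProduct.AlgebraTensorModule.curry_apply, TensorProduct.curry_apply,
          LinearMap.coe_restrictScalars, AlgHom.toLinearMap_apply, AlgHom.comp_apply]
        change AlgHom.mulLeftRight C (A ⊗[C] B) (E ((a ⊗ₜ a') ⊗ₜ (b ⊗ₜ b'))) (x ⊗ₜ y) =
          G ((a ⊗ₜ a') ⊗ₜ (b ⊗ₜ b')) (x ⊗ₜ y)
        rw [hE, hG]
        simp
      have h2 : Function.Bijective ((AlgHom.mulLeftRight C (A ⊗[C] B)) ∘ E) := by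
        have h3 : (AlgHom.mulLeftRight C (A ⊗[C] B)) ∘ E = G :=
          funext fun x => DFunLike.congr_fun h x
        rw [h3]; exact G.bijective
      exact (Function.Bijective.of_comp_iff _ E.bijective).1 h2 }

theorem isAzumaya_op (A : Type u) [Ring A] [Algebra C A] [IsAzumaya C A] : IsAzumaya C Aᵐᵒᵖ :=
  { toProjective := Module.Projective.of_equiv (MulOpposite.opLinearEquiv C : A ≃ₗ[C] Aᵐᵒᵖ)
    toFaithfulSMul := ⟨fun {x y} h => FaithfulSMul.eq_of_smul_eq_smul (α := A) fun a =>
      MulOpposite.op_injective (h (MulOpposite.op a))⟩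
    toFinite := Module.Finite.equiv (MulOpposite.opLinearEquiv C : A ≃ₗ[C] Aᵐᵒᵖ)
    bij := by
      let E : A ⊗[C] Aᵐᵒᵖ ≃ₐ[C] Aᵐᵒᵖ ⊗[C] Aᵐᵒᵖᵐᵒᵖ :=
        (Algebra.TensorProduct.comm C A Aᵐᵒᵖ).trans
          (Algebra.TensorProduct.congr AlgEquiv.refl (AlgEquiv.opOp C A))
      let G : A ⊗[C] Aᵐᵒᵖ ≃ₐ[C] Module.End C Aᵐᵒᵖ :=
        (AlgEquiv.ofBijective (AlgHom.mulLeftRight C A) IsAzumaya.bij).trans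
          ((MulOpposite.opLinearEquiv C : A ≃ₗ[C] Aᵐᵒᵖ).conjAlgEquiv C)
      have h : (AlgHom.mulLeftRight C Aᵐᵒᵖ).comp E.toAlgHom = G.toAlgHom := by
        ext <;> simp [E, G]
      have h2 : Function.Bijective ((AlgHom.mulLeftRight C Aᵐᵒᵖ) ∘ E) := by
        have h3 : (AlgHom.mulLeftRight C Aᵐᵒᵖ) ∘ E = G :=
          funext fun x => DFunLike.congr_fun h x
        rw [h3]; exact G.bijective
      exact (Function.Bijective.of_comp_iff _ E.bijective).1 h2 }

end Closure

/-! ### The Brauer group of a commutative ring -/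

/-- The Azumaya algebras over a commutative ring `C`. -/
structure Alg (C : Type u) [CommRing C] where
  /-- The underlying type. -/
  carrier : Type u
  [ring : Ring carrier]
  [algebra : Algebra C carrier]
  [isAzumaya : IsAzumaya C carrier]

attribute [instance] Alg.ring Alg.algebra Alg.isAzumaya

/-- Brauer equivalence of `C`-algebras: `A ⊗ End P ≃ B ⊗ End Q` for some finitely generated,
projective, faithful `C`-modules `P` and `Q`. -/
def BrauerEquivalent (C A B : Type u) [CommRing C] [Ring A] [Algebra C A] [Ring B] [Algebra C B] :
    Prop :=
  ∃ (P Q : Type u) (_ : AddCommGroup P) (_ : Module C P) (_ : AddCommGroup Q) (_ : Module C Q),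
    (Module.Finite C P ∧ Module.Projective C P ∧ FaithfulSMul C P) ∧
    (Module.Finite C Q ∧ Module.Projective C Q ∧ FaithfulSMul C Q) ∧
    Nonempty (A ⊗[C] Module.End C P ≃ₐ[C] B ⊗[C] Module.End C Q)

namespace BrauerEquivalent

variable {C A B D A' B' : Type u} [CommRing C] [Ring A] [Algebra C A] [Ring B] [Algebra C B]
  [Ring D] [Algebra C D] [Ring A'] [Algebra C A'] [Ring B'] [Algebra C B']

theorem of_algEquiv (e : A ≃ₐ[C] B) : BrauerEquivalent C A B :=
  ⟨C, C, inferInstance, inferInstance, inferInstance, inferInstance,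
    ⟨inferInstance, inferInstance, inferInstance⟩, ⟨inferInstance, inferInstance, inferInstance⟩,
    ⟨Algebra.TensorProduct.congr e AlgEquiv.refl⟩⟩

theorem symm (h : BrauerEquivalent C A B) : BrauerEquivalent C B A := by
  obtain ⟨P, Q, _, _, _, _, hP, hQ, ⟨e⟩⟩ := h
  exact ⟨Q, P, inferInstance, inferInstance, inferInstance, inferInstance, hQ, hP, ⟨e.symm⟩⟩

theorem trans (h : BrauerEquivalent C A B) (h' : BrauerEquivalent C B D) :
    BrauerEquivalent C A D := by
  obtain ⟨P, Q, _, _, _, _, ⟨_, _, _⟩, ⟨_, _, _⟩, ⟨e⟩⟩ := h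
  obtain ⟨R, S, _, _, _, _, ⟨_, _, _⟩, ⟨_, _, _⟩, ⟨f⟩⟩ := h'
  refine ⟨P ⊗[C] R, S ⊗[C] Q, inferInstance, inferInstance, inferInstance, inferInstance,
    ⟨inferInstance, inferInstance, faithfulSMul_tensor⟩,
    ⟨inferInstance, inferInstance, faithfulSMul_tensor⟩, ⟨?_⟩⟩
  have e1 : A ⊗[C] Module.End C (P ⊗[C] R) ≃ₐ[C] (A ⊗[C] Module.End C P) ⊗[C] Module.End C R :=
    (Algebra.TensorProduct.congr AlgEquiv.refl (endTensorEquiv P R).symm).trans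
      (Algebra.TensorProduct.assoc C C C A (Module.End C P) (Module.End C R)).symm
  have e2 : (B ⊗[C] Module.End C Q) ⊗[C] Module.End C R ≃ₐ[C]
      (B ⊗[C] Module.End C R) ⊗[C] Module.End C Q :=
    ((Algebra.TensorProduct.assoc C C C B (Module.End C Q) (Module.End C R)).trans
      (Algebra.TensorProduct.congr AlgEquiv.refl (Algebra.TensorProduct.comm C _ _))).trans
      (Algebra.TensorProduct.assoc C C C B (Module.End C R) (Module.End C Q)).symm
  have e3 : (D ⊗[C] Module.End C S) ⊗[C] Module.End C Q ≃ₐ[C] D ⊗[C] Module.End C (S ⊗[C] Q) :=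
    (Algebra.TensorProduct.assoc C C C D (Module.End C S) (Module.End C Q)).trans
      (Algebra.TensorProduct.congr AlgEquiv.refl (endTensorEquiv S Q))
  exact ((((e1.trans (Algebra.TensorProduct.congr e AlgEquiv.refl)).trans e2).trans
    (Algebra.TensorProduct.congr f AlgEquiv.refl)).trans e3)

theorem tensor (h : BrauerEquivalent C A A') (h' : BrauerEquivalent C B B') :
    BrauerEquivalent C (A ⊗[C] B) (A' ⊗[C] B') := by
  obtain ⟨P, Q, _, _, _, _, ⟨_, _, _⟩, ⟨_, _, _⟩, ⟨e⟩⟩ := h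
  obtain ⟨R, S, _, _, _, _, ⟨_, _, _⟩, ⟨_, _, _⟩, ⟨f⟩⟩ := h'
  refine ⟨P ⊗[C] R, Q ⊗[C] S, inferInstance, inferInstance, inferInstance, inferInstance,
    ⟨inferInstance, inferInstance, faithfulSMul_tensor⟩,
    ⟨inferInstance, inferInstance, faithfulSMul_tensor⟩, ⟨?_⟩⟩
  have e1 : (A ⊗[C] B) ⊗[C] Module.End C (P ⊗[C] R) ≃ₐ[C]
      (A ⊗[C] Module.End C P) ⊗[C] (B ⊗[C] Module.End C R) :=
    (Algebra.TensorProduct.congr AlgEquiv.refl (endTensorEquiv P R).symm).trans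
      (Algebra.TensorProduct.tensorTensorTensorComm C C C C A B _ _)
  have e2 : (A' ⊗[C] Module.End C Q) ⊗[C] (B' ⊗[C] Module.End C S) ≃ₐ[C]
      (A' ⊗[C] B') ⊗[C] Module.End C (Q ⊗[C] S) :=
    (Algebra.TensorProduct.tensorTensorTensorComm C C C C A' _ B' _).trans
      (Algebra.TensorProduct.congr AlgEquiv.refl (endTensorEquiv Q S))
  exact (e1.trans (Algebra.TensorProduct.congr e f)).trans e2

theorem op_left [IsAzumaya C A] : BrauerEquivalent C (Aᵐᵒᵖ ⊗[C] A) C :=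
  ⟨C, A, inferInstance, inferInstance, inferInstance, inferInstance,
    ⟨inferInstance, inferInstance, inferInstance⟩, ⟨inferInstance, inferInstance, inferInstance⟩,
    ⟨((Algebra.TensorProduct.congr AlgEquiv.refl
        ((AlgEquiv.moduleEndSelf C).symm.trans (AlgEquiv.toOpposite C C).symm)).trans (Algebra.TensorProduct.rid C C _)).trans
      (((Algebra.TensorProduct.comm C Aᵐᵒᵖ A).trans
        (AlgEquiv.ofBijective (AlgHom.mulLeftRight C A) IsAzumaya.bij)).trans
        (Algebra.TensorProduct.lid C _).symm)⟩⟩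

theorem op [IsAzumaya C A] [IsAzumaya C B] (h : BrauerEquivalent C A B) :
    BrauerEquivalent C Aᵐᵒᵖ Bᵐᵒᵖ := by
  have h1 : BrauerEquivalent C Aᵐᵒᵖ (Aᵐᵒᵖ ⊗[C] (Bᵐᵒᵖ ⊗[C] B)) :=
    (of_algEquiv (Algebra.TensorProduct.rid C C Aᵐᵒᵖ).symm).trans
      (tensor (of_algEquiv AlgEquiv.refl) op_left.symm)
  have h2 : BrauerEquivalent C (Aᵐᵒᵖ ⊗[C] (Bᵐᵒᵖ ⊗[C] B)) (Aᵐᵒᵖ ⊗[C] (Bᵐᵒᵖ ⊗[C] A)) :=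
    tensor (of_algEquiv AlgEquiv.refl) (tensor (of_algEquiv AlgEquiv.refl) h.symm)
  have h3 : BrauerEquivalent C (Aᵐᵒᵖ ⊗[C] (Bᵐᵒᵖ ⊗[C] A)) ((Aᵐᵒᵖ ⊗[C] A) ⊗[C] Bᵐᵒᵖ) :=
    of_algEquiv ((Algebra.TensorProduct.congr AlgEquiv.refl
      (Algebra.TensorProduct.comm C Bᵐᵒᵖ A)).trans
        (Algebra.TensorProduct.assoc C C C Aᵐᵒᵖ A Bᵐᵒᵖ).symm)
  have h4 : BrauerEquivalent C ((Aᵐᵒᵖ ⊗[C] A) ⊗[C] Bᵐᵒᵖ) Bᵐᵒᵖ :=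
    (tensor (op_left (C := C) (A := A)) (of_algEquiv AlgEquiv.refl)).trans
      (of_algEquiv (Algebra.TensorProduct.lid C Bᵐᵒᵖ))
  exact ((h1.trans h2).trans h3).trans h4

end BrauerEquivalent

/-- Brauer equivalence as an equivalence relation on the Azumaya algebras over `C`. -/
instance brauerSetoid (C : Type u) [CommRing C] : Setoid (Alg C) where
  r A B := BrauerEquivalent C A.carrier B.carrier
  iseqv :=
    { refl := fun _ => BrauerEquivalent.of_algEquiv AlgEquiv.refl
      symm := BrauerEquivalent.symm
      trans := BrauerEquivalent.trans }

/-- The Brauer group `Br(C)` of a commutative ring `C`: Azumaya algebras over `C` up to Brauer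
equivalence. -/
def Br (C : Type u) [CommRing C] : Type (u + 1) := Quotient (brauerSetoid C)

/-- The class in `Br(C)` of an Azumaya algebra. -/
def brauerClass (C A : Type u) [CommRing C] [Ring A] [Algebra C A] [IsAzumaya C A] : Br C :=
  Quotient.mk (brauerSetoid C) ⟨A⟩

/-- The group law on `Br(C)` is the tensor product over `C`; the unit is the class of `C`, and the
inverse is the opposite algebra. -/
noncomputable instance (C : Type u) [CommRing C] : CommGroup (Br C) where
  mul := Quotient.map₂
    (fun A B => have := isAzumaya_tensor (C := C) A.carrier B.carrier
      ⟨A.carrier ⊗[C] B.carrier⟩)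
    (fun _ _ h _ _ h' => BrauerEquivalent.tensor h h')
  one := brauerClass C C
  inv := Quotient.map
    (fun A => have := isAzumaya_op (C := C) A.carrier
      ⟨A.carrierᵐᵒᵖ⟩)
    (fun _ _ h => BrauerEquivalent.op h)
  mul_assoc := by
    rintro ⟨A⟩ ⟨B⟩ ⟨D⟩
    exact Quotient.sound (s := brauerSetoid C)
      (BrauerEquivalent.of_algEquiv (Algebra.TensorProduct.assoc C C C _ _ _))
  one_mul := by
    rintro ⟨A⟩
    exact Quotient.sound (s := brauerSetoid C)
      (BrauerEquivalent.of_algEquiv (Algebra.TensorProduct.lid C _))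
  mul_one := by
    rintro ⟨A⟩
    exact Quotient.sound (s := brauerSetoid C)
      (BrauerEquivalent.of_algEquiv (Algebra.TensorProduct.rid C C _))
  mul_comm := by
    rintro ⟨A⟩ ⟨B⟩
    exact Quotient.sound (s := brauerSetoid C)
      (BrauerEquivalent.of_algEquiv (Algebra.TensorProduct.comm C _ _))
  inv_mul_cancel := by
    rintro ⟨A⟩
    exact Quotient.sound (s := brauerSetoid C) BrauerEquivalent.op_left

/-- The period of an Azumaya algebra: the order of its class in the Brauer group (`0` if the order
is infinite). -/
noncomputable def period (C A : Type u) [CommRing C] [Ring A] [Algebra C A] [IsAzumaya C A] : ℕ :=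
  orderOf (brauerClass C A)

/-! ### Reduced traces and dimension vectors -/

/-- An étale splitting of a `C`-algebra `B`: an étale cover `C → D₁, …, C → Dᵣ`
together with isomorphisms of `Dᵢ ⊗ B` with matrix algebras over `Dᵢ`. -/
structure EtaleSplitting (C B : Type u) [CommRing C] [Ring B] [Algebra C B] where
  /-- The number of members of the cover. -/
  r : ℕ
  /-- The members of the cover. -/
  D : Fin r → Type u
  [commRing : ∀ i, CommRing (D i)]
  [algebra : ∀ i, Algebra C (D i)]
  etale : ∀ i, Algebra.Etale C (D i)
  faithfullyFlat : Module.FaithfullyFlat C (∀ i, D i)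
  /-- The sizes of the matrices. -/
  n : Fin r → ℕ
  n_pos : ∀ i, 0 < n i
  /-- The splitting isomorphisms. -/
  iso : ∀ i, D i ⊗[C] B ≃ₐ[D i] Matrix (Fin (n i)) (Fin (n i)) (D i)

attribute [instance] EtaleSplitting.commRing EtaleSplitting.algebra

/-- `t : C` is the (reduced) trace of the element `b` of the Azumaya algebra `B`: on an étale
splitting of `B`, the image of `b` has matrix trace `t`. (The reduced trace does not depend on the
splitting.) -/
def IsReducedTrace {C B : Type u} [CommRing C] [Ring B] [Algebra C B] (b : B) (t : C) : Prop :=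
  ∃ S : EtaleSplitting C B, ∀ i, (S.iso i (1 ⊗ₜ[C] b)).trace = algebraMap C (S.D i) t

/-- The family `e₁, …, e_k` makes the `C`-algebra `B` into an algebra of dimension vector
`(d₁, …, d_k)`: it is a complete set of orthogonal idempotents, and `eᵢ` has trace `dᵢ`. -/
structure HasDimensionVector (C : Type u) {B : Type u} [CommRing C] [Ring B] [Algebra C B] {k : ℕ}
    (d : Fin k → ℕ) (e : Fin k → B) : Prop where
  idempotents : CompleteOrthogonalIdempotents e
  trace : ∀ i, IsReducedTrace (e i) (d i : C)

end Azumaya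

/-! It suffices to show `[B]^d = 1` whenever `B` contains an idempotent `e` of reduced trace `d >
0`. After splitting, `e` is a projection whose image has rank `d`, and the antisymmetrizer of the
`d`-th tensor power, multiplied by `e ⊗ ⋯ ⊗ e`, is `d!` times a projection onto the line `Λ^d (im
e)`. This element is defined over `C`: the reduced trace is a sum of two-sided multiplications `x ↦
∑ aₗ x bₗ`, and the Goldman element `∑ aₗ ⊗ bₗ` of `B ⊗ B` acts as the swap of the two factors, so
transpositions, hence antisymmetrizers, live in tensor powers of `B`. An algebra `E` with a full
idempotent `ε` of rank one is `End (E ε)`, so `B^{⊗d}` has trivial class.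

Over the cover everything becomes a statement about minors, the matrix entries of the
antisymmetrized element. Their diagonal sum is `d(d-1)⋯1 = d!` (`Matrix.sum_det_submatrix_self`),
and they form a matrix with vanishing `2 × 2` minors (`Matrix.det_submatrix_mul_det_submatrix`).
Faithfully flat descent brings both facts back to `C`, where `brauerEquivalent_of_rankOne` applies.
Characteristic zero makes `d` and `d!` invertible and lets the trace of a projection determine its
rank. -/

namespace Matrix
-- Minors of idempotent matrices.
section Minors
variable {R n : Type*} [CommRing R]

/-- Expansion of a minor of size `m + 1` by cosets of the stabiliser of `0`. -/
theorem det_submatrix_succ (M : Matrix n n R) {m : ℕ} (f h : Fin (m + 1) → n) :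
    (M.submatrix f h).det =
      M (f 0) (h 0) * (M.submatrix (Fin.tail f) (Fin.tail h)).det -
        ∑ i, M (f i.succ) (h 0) *
          (M.submatrix (Function.update (Fin.tail f) i (f 0)) (Fin.tail h)).det := by
  have key : ∀ (i k : Fin m), f (Equiv.swap 0 i.succ k.succ) =
      Function.update (Fin.tail f) i (f 0) k := by
    intro i k
    by_cases hk : k = i
    · subst hk; simp
    · rw [Equiv.swap_apply_of_ne_of_ne (Fin.succ_ne_zero k)
        (fun h => hk (Fin.succ_injective _ h)), Function.update_of_ne hk]
      rfl
  -- A permutation of `Fin (m + 1)` is uniquely `swap 0 p` times a permutation fixing `0`; `p = 0`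
  -- gives the first term and each `p = i.succ` a term with opposite sign.
  rw [det_apply', ← Equiv.Perm.decomposeFin.symm.sum_comp, Fintype.sum_prod_type,
    Fin.sum_univ_succ, sub_eq_add_neg, ← Finset.sum_neg_distrib]
  congr 1
  · rw [det_apply', Finset.mul_sum]
    refine Finset.sum_congr rfl fun σ _ => ?_
    rw [Equiv.Perm.decomposeFin.symm_sign, Fin.prod_univ_succ]
    simp [Fin.tail]
    ring
  · refine Finset.sum_congr rfl fun i _ => ?_
    rw [det_apply', Finset.mul_sum, ← Finset.sum_neg_distrib]
    refine Finset.sum_congr rfl fun σ _ => ?_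
    rw [Equiv.Perm.decomposeFin.symm_sign, Fin.prod_univ_succ]
    simp [Fin.tail, key]
    ring

/-- Linearity of the determinant in row `i`. For `A = M` idempotent the new row is the old one, so
the sum returns the minor itself. -/
theorem sum_mul_det_submatrix_update [Fintype n] (A M : Matrix n n R) {m : ℕ}
    (f h : Fin m → n) (i : Fin m) :
    ∑ c, A (f i) c * (M.submatrix (Function.update f i c) h).det =
      ((M.submatrix f h).updateRow i fun j => (A * M) (f i) (h j)).det := by
  have h1 : ∀ c, M.submatrix (Function.update f i c) h =
      (M.submatrix f h).updateRow i fun j => M c (h j) := by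
    intro c
    ext a b
    by_cases ha : a = i
    · subst ha; simp
    · simp [ha]
  have h2 : (fun j => (A * M) (f i) (h j)) = ∑ c, A (f i) c • fun j => M c (h j) := by
    ext j
    simp [Matrix.mul_apply]
  have h3 := map_sum ((detRowAlternating : (Fin m → R) [⋀^Fin m]→ₗ[R] R).toMultilinearMap.toLinearMap
    (M.submatrix f h) i) (fun c => A (f i) c • fun j => M c (h j)) Finset.univ
  simp only [h1, h2]
  refine (h3.trans (Finset.sum_congr rfl fun c _ => ?_)).symm
  rw [map_smul]
  rfl

/-- Expand the minor indexed by `(c, f)` and sum over `c`: the leading term contributes `e.trace`,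
and idempotency turns each of the `m` correction terms into the minor of `f`. Hence each step
multiplies by `e.trace - m`. -/
theorem sum_det_submatrix_self [Fintype n] {e : Matrix n n R} (he : e * e = e) (m : ℕ) :
    ∑ f : Fin m → n, (e.submatrix f f).det = ∏ i ∈ Finset.range m, (e.trace - i) := by
  induction m with
  | zero => simp
  | succ m ih =>
    rw [← (Fin.consEquiv fun _ => n).sum_comp, Fintype.sum_prod_type, Finset.prod_range_succ,
      ← ih, Finset.sum_comm, Finset.sum_mul]
    refine Finset.sum_congr rfl fun f _ => ?_
    have h1 : ∀ i, ∑ c, e (f i) c * (e.submatrix (Function.update f i c) f).det =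
        (e.submatrix f f).det := by
      intro i
      rw [sum_mul_det_submatrix_update, he]
      congr 1
      exact updateRow_eq_self _ _
    have h2 : ∀ c, (e.submatrix (Fin.cons c f : Fin (m + 1) → n) (Fin.cons c f)).det =
        e c c * (e.submatrix f f).det -
          ∑ i, e (f i) c * (e.submatrix (Function.update f i c) f).det :=
      fun c => det_submatrix_succ e _ _
    refine (Finset.sum_congr rfl fun c _ => h2 c).trans ?_
    rw [Finset.sum_sub_distrib, Finset.sum_comm (γ := n), ← Finset.sum_mul]
    simp only [h1, trace, diag_apply, Finset.sum_const, Finset.card_univ, Fintype.card_fin,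
      nsmul_eq_mul]
    ring

/-- Over a local ring the image and the kernel of a projection are free, so `e` factors through its
image, a free module whose rank is read off from the trace. -/
theorem exists_factorization_of_isLocalRing [Fintype n] [IsLocalRing R] [CharZero R]
    {e : Matrix n n R} (he : e * e = e) {d : ℕ} (hd : e.trace = d) :
    ∃ (U : Matrix n (Fin d) R) (V : Matrix (Fin d) n R), e = U * V := by
  classical
  let φ := Matrix.toLin' e
  have hφ : IsIdempotentElem φ := by
    change toLin' e ∘ₗ toLin' e = toLin' e
    rw [← Matrix.toLin'_mul, he]
  have hp := LinearMap.IsIdempotentElem.isProj_range _ hφ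
  have hq := LinearMap.IsIdempotentElem.isProj_range _ hφ.one_sub
  have hk : LinearMap.range (1 - φ) = LinearMap.ker φ := by
    exact (LinearMap.IsIdempotentElem.ker_eq_range hφ).symm
  rw [hk] at hq
  have : Module.Projective R (LinearMap.range φ) :=
    .of_split (Submodule.subtype _) hp.codRestrict (by ext x; simp)
  have : Module.Projective R (LinearMap.ker φ) :=
    .of_split (Submodule.subtype _) hq.codRestrict (by ext x; simp)
  have : Module.Finite R (LinearMap.ker φ) := .of_surjective hq.codRestrict fun x => ⟨x, by simp⟩
  have := Module.free_of_flat_of_isLocalRing (R := R) (P := LinearMap.range φ)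
  have := Module.free_of_flat_of_isLocalRing (R := R) (P := LinearMap.ker φ)
  -- The trace of a projection is the rank of its image, as an element of `R`; `CharZero` lifts the
  -- equality with `d` to `ℕ`.
  have hr := hp.trace
  rw [Matrix.trace_toLin'_eq, hd, Nat.cast_inj] at hr
  let b := Module.finBasisOfFinrankEq R (LinearMap.range φ) hr.symm
  refine ⟨LinearMap.toMatrix b (Pi.basisFun R n) (Submodule.subtype _),
    LinearMap.toMatrix (Pi.basisFun R n) b hp.codRestrict, ?_⟩
  rw [← LinearMap.toMatrix_comp]
  have : e = LinearMap.toMatrix (Pi.basisFun R n) (Pi.basisFun R n) φ := by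
    simp [φ]
  exact this

/-- Since the inner dimension is exactly `d`, a `d`-minor of `U * V` is a minor of `U` times a minor
of `V`: the matrix of `d`-minors is a column times a row. -/
theorem det_submatrix_mul_det_submatrix_of_eq_mul {d : ℕ} {U : Matrix n (Fin d) R}
    {V : Matrix (Fin d) n R} (f h f' h' : Fin d → n) :
    ((U * V).submatrix f h).det * ((U * V).submatrix f' h').det =
      ((U * V).submatrix f h').det * ((U * V).submatrix f' h).det := by
  have key : ∀ f h : Fin d → n, ((U * V).submatrix f h).det =
      (U.submatrix f id).det * (V.submatrix id h).det := by
    intro f h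
    rw [← det_mul, submatrix_mul _ _ f id h Function.bijective_id]
  simp only [key]
  ring

/-- An identity in `R` can be checked in the localizations at maximal ideals, where `e` factors
through a free module of rank `d`. This says that `Λ^d e` has rank at most one. -/
theorem det_submatrix_mul_det_submatrix [Fintype n] [Algebra ℚ R] {e : Matrix n n R} (he : e * e = e)
    {d : ℕ} (hd : e.trace = d) (f h f' h' : Fin d → n) :
    (e.submatrix f h).det * (e.submatrix f' h').det =
      (e.submatrix f h').det * (e.submatrix f' h).det := by
  rw [← sub_eq_zero]
  refine eq_zero_of_localization _ fun J hJ => ?_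
  let L := Localization.AtPrime J
  have : CharZero L := algebraRat.charZero L
  let g : R →+* L := algebraMap R L
  have h1 : e.map g * e.map g = e.map g := by rw [← Matrix.map_mul, he]
  have h2 : (e.map g).trace = d := by
    rw [← AddMonoidHom.map_trace, hd]; simp
  obtain ⟨U, V, hUV⟩ := exists_factorization_of_isLocalRing h1 h2
  have h3 : ∀ f h : Fin d → n, g (e.submatrix f h).det = ((U * V).submatrix f h).det := by
    intro f h
    rw [← hUV, RingHom.map_det]
    rfl
  change g _ = 0
  rw [map_sub, map_mul, map_mul, h3, h3, h3, h3, sub_eq_zero]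
  exact det_submatrix_mul_det_submatrix_of_eq_mul f h f' h'

end Minors
end Matrix

/-! ### Descent of identities and of the reduced trace along a splitting cover. -/

namespace Matrix

/-- A linear map on matrices over `D` that kills all commutators factors through the trace. -/
theorem map_eq_of_commutator {D Q ι : Type*} [CommRing D] [AddCommGroup Q] [Module D Q]
    [Fintype ι] [DecidableEq ι] (q : Matrix ι ι D →ₗ[D] Q) (hq : ∀ X Y, q (X * Y) = q (Y * X))
    (i : ι) (X : Matrix ι ι D) : q X = X.trace • q (single i i 1) := by
  have h1 : ∀ (k l : ι) (a : D), q (single k l a) = if k = l then a • q (single i i 1) else 0 := by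
    intro k l a
    split_ifs with h
    · subst h
      have h2 := hq (single k i a) (single i k 1)
      rw [single_mul_single_same, single_mul_single_same, mul_one, one_mul] at h2
      rw [h2, ← map_smul, smul_single, smul_eq_mul, mul_one]
    · have h2 := hq (single k k 1) (single k l a)
      rwa [single_mul_single_same, one_mul, single_mul_single_of_ne _ _ _ _ (Ne.symm h),
        map_zero] at h2
  conv_lhs => rw [matrix_eq_sum_single X]
  rw [map_sum, trace, Finset.sum_smul]
  refine Finset.sum_congr rfl fun k _ => ?_
  rw [map_sum, Finset.sum_congr rfl fun l _ => h1 k l _]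
  simp

end Matrix

namespace Azumaya

section Descent

variable {C : Type u} [CommRing C]

theorem eq_zero_of_forall_one_tmul {J : Type*} [Fintype J] {D : J → Type u}
    [∀ j, CommRing (D j)] [∀ j, Algebra C (D j)] [Module.FaithfullyFlat C (∀ j, D j)]
    {M : Type u} [AddCommGroup M] [Module C M] {m : M}
    (h : ∀ j, (1 : D j) ⊗ₜ[C] m = 0) : m = 0 := by
  classical
  rw [← Module.FaithfullyFlat.one_tmul_eq_zero_iff C M (A := ∀ j, D j)]
  apply (TensorProduct.piLeft C M D).injective
  ext j
  simpa using h j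

theorem eq_zero_of_isBaseChange {J : Type*} [Fintype J] {D : J → Type u}
    [∀ j, CommRing (D j)] [∀ j, Algebra C (D j)] [Module.FaithfullyFlat C (∀ j, D j)]
    {M : Type u} [AddCommGroup M] [Module C M] {N : J → Type u} [∀ j, AddCommGroup (N j)]
    [∀ j, Module C (N j)] [∀ j, Module (D j) (N j)] [∀ j, IsScalarTower C (D j) (N j)]
    {f : ∀ j, M →ₗ[C] N j} (hf : ∀ j, IsBaseChange (D j) (f j)) {m : M}
    (h : ∀ j, f j m = 0) : m = 0 :=
  eq_zero_of_forall_one_tmul (D := D) fun j => by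
    rw [← (hf j).equiv_symm_apply, h, map_zero]

theorem algebraMap_pi_injective {J : Type*} {D : J → Type u}
    [∀ j, CommRing (D j)] [∀ j, Algebra C (D j)] [Module.FaithfullyFlat C (∀ j, D j)] :
    Function.Injective (algebraMap C (∀ j, D j)) :=
  FaithfulSMul.algebraMap_injective _ _

end Descent

section Splitting

variable {C B : Type u} [CommRing C] [Ring B] [Algebra C B]

/-- The matrix representation of `B` over a member of a splitting cover. -/
noncomputable def EtaleSplitting.rep (S : EtaleSplitting C B) (j : Fin S.r) :
    B →ₐ[C] Matrix (Fin (S.n j)) (Fin (S.n j)) (S.D j) :=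
  ((S.iso j).toAlgHom.restrictScalars C).comp Algebra.TensorProduct.includeRight

theorem EtaleSplitting.isBaseChange_rep (S : EtaleSplitting C B) (j : Fin S.r) :
    IsBaseChange (S.D j) (S.rep j).toLinearMap :=
  .of_equiv (S.iso j).toLinearEquiv fun _ => rfl

/-- The reduced trace is defined over the base as soon as some element has reduced trace
a unit of the base. -/
theorem EtaleSplitting.exists_trace (S : EtaleSplitting C B) {e : B} {t : C} (ht : IsUnit t)
    (he : ∀ j, (S.rep j e).trace = algebraMap C (S.D j) t) :
    ∃ T : B →ₗ[C] C, ∀ j b, algebraMap C (S.D j) (T b) = (S.rep j b).trace := by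
  have := S.faithfullyFlat
  let φ : C →ₗ[C] ∀ j, S.D j := Algebra.linearMap C _
  have hφ : Function.Injective φ := algebraMap_pi_injective
  let τ : B →ₗ[C] ∀ j, S.D j := LinearMap.pi fun j =>
    (Matrix.traceLinearMap (Fin (S.n j)) C (S.D j)) ∘ₗ (S.rep j).toLinearMap
  let N : Submodule C B := (LinearMap.range φ).comap τ
  -- `N` consists of the elements whose trace lies in `C`. It contains all commutators and `e`.
  -- After base change, the quotient map by `N` therefore factors through the matrix trace and kills
  -- an element of unit trace, so it vanishes; no comparison on the overlaps of the cover is needed.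
  have hN : ∀ b, b ∈ N := by
    intro b
    rw [← Submodule.Quotient.mk_eq_zero]
    refine eq_zero_of_forall_one_tmul (C := C) (D := S.D) fun j => ?_
    let f : B →ₗ[C] S.D j ⊗[C] (B ⧸ N) := TensorProduct.mk C (S.D j) (B ⧸ N) 1 ∘ₗ N.mkQ
    let q := (S.isBaseChange_rep j).lift f
    have hq : ∀ b, q (S.rep j b) = f b := (S.isBaseChange_rep j).lift_eq f
    have hf : ∀ b ∈ N, f b = 0 := by
      intro b hb
      have : N.mkQ b = 0 := (Submodule.Quotient.mk_eq_zero N).2 hb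
      simp [f, this]
    have hcomm : ∀ X Y, q (X * Y) = q (Y * X) := by
      intro X Y
      induction X using (S.isBaseChange_rep j).inductionOn with
      | zero => simp
      | add X₁ X₂ h₁ h₂ => rw [add_mul, mul_add, map_add, map_add, h₁, h₂]
      | smul s X h => rw [smul_mul_assoc, mul_smul_comm, map_smul, map_smul, h]
      | tmul x =>
        induction Y using (S.isBaseChange_rep j).inductionOn with
        | zero => simp
        | add X₁ X₂ h₁ h₂ => rw [add_mul, mul_add, map_add, map_add, h₁, h₂]
        | smul s X h => rw [smul_mul_assoc, mul_smul_comm, map_smul, map_smul, h]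
        | tmul y =>
          simp only [AlgHom.toLinearMap_apply, ← map_mul, hq]
          rw [← sub_eq_zero, ← map_sub]
          -- A commutator has trace `0`, which lies in `C`.
          refine hf _ ⟨0, ?_⟩
          ext j
          simp [τ, Matrix.trace_mul_comm (S.rep j x)]
    have he' : f e = 0 := hf _ ⟨t, by ext j; exact (he j).symm⟩
    let i : Fin (S.n j) := ⟨0, S.n_pos j⟩
    have h1 := Matrix.map_eq_of_commutator q hcomm i
    have h2 : q (Matrix.single i i 1) = 0 := by
      have h3 := h1 (S.rep j e)
      rw [hq, he', he] at h3
      exact ((ht.map (algebraMap C (S.D j))).smul_eq_zero).1 h3.symm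
    change f b = 0
    rw [← hq, h1, h2, smul_zero]
  refine ⟨(LinearEquiv.ofInjective φ hφ).symm ∘ₗ τ.codRestrict (LinearMap.range φ) hN,
    fun j b => ?_⟩
  have h := congrArg Subtype.val ((LinearEquiv.ofInjective φ hφ).apply_symm_apply
    (τ.codRestrict (LinearMap.range φ) hN b))
  exact congrFun h j

end Splitting

/-! ### The Goldman element. -/

section Goldman

variable {C E : Type u} [CommRing C] [Ring E] [Algebra C E]

/-- Every linear endomorphism of an Azumaya algebra is a sum of two-sided multiplications; here for
an endomorphism with values in the base. -/
theorem exists_sum_mul_mul_eq [IsAzumaya C E] (T : E →ₗ[C] C) :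
    ∃ (k : ℕ) (a b : Fin k → E), ∀ x, ∑ l, a l * x * b l = algebraMap C E (T x) := by
  obtain ⟨z, hz⟩ := (IsAzumaya.bij (R := C) (A := E)).2 (Algebra.linearMap C E ∘ₗ T)
  obtain ⟨k, a, b, rfl⟩ := TensorProduct.exists_sum_tmul_eq z
  refine ⟨k, a, fun l => (b l).unop, fun x => ?_⟩
  have h := LinearMap.congr_fun hz x
  simpa using h

/-- By base change `∑ aₗ X bₗ = tr X` for every matrix `X` over `D`; taking `X` elementary isolates
the entries of `∑ aₗ ⊗ bₗ`, which are those of the swap of the two tensor factors. -/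
theorem sum_mul_eq_ite {D ι κ : Type*} [CommRing D] [Algebra C D] [Fintype ι] [DecidableEq ι]
    [Fintype κ] {ρ : E →ₐ[C] Matrix ι ι D} (hρ : IsBaseChange D ρ.toLinearMap)
    {T : E →ₗ[C] C} (hT : ∀ x, algebraMap C D (T x) = (ρ x).trace) {a b : κ → E}
    (hab : ∀ x, ∑ l, a l * x * b l = algebraMap C E (T x)) (i j i' j' : ι) :
    ∑ l, ρ (a l) i j * ρ (b l) i' j' = if i = j' ∧ i' = j then 1 else 0 := by
  have key : ∀ X : Matrix ι ι D, ∑ l, ρ (a l) * X * ρ (b l) = algebraMap D _ X.trace := by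
    intro X
    induction X using hρ.inductionOn with
    | zero => simp
    | add X Y hX hY =>
      rw [Matrix.trace_add, map_add, ← hX, ← hY, ← Finset.sum_add_distrib]
      simp only [mul_add, add_mul]
    | smul s X hX =>
      rw [Matrix.trace_smul, Algebra.algebraMap_eq_smul_one, smul_assoc,
        ← Algebra.algebraMap_eq_smul_one, ← hX, Finset.smul_sum]
      simp only [mul_smul_comm, smul_mul_assoc]
    | tmul x =>
      simp only [AlgHom.toLinearMap_apply, ← map_mul, ← map_sum, hab, ← hT]
      rw [AlgHom.commutes, ← IsScalarTower.algebraMap_apply]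
  have h := congrFun (congrFun (key (Matrix.single j i' 1)) i) j'
  rw [Matrix.sum_apply] at h
  have h2 : ∀ l, (ρ (a l) * Matrix.single j i' 1 * ρ (b l) : Matrix ι ι D) i j' =
      ρ (a l) i j * ρ (b l) i' j' := by
    intro l
    simp [Matrix.mul_apply, Matrix.single_apply, ite_and]
  simp only [h2] at h
  rw [h, Matrix.algebraMap_matrix_apply]
  by_cases h3 : i' = j
  · subst h3; simp
  · simp [h3, Matrix.trace_single_eq_of_ne _ _ _ (Ne.symm h3)]

end Goldman

/-! ### Kronecker products of matrix representations. -/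

section KroneckerRep

variable {C A E D ι κ : Type*} [CommRing C] [Ring A] [Algebra C A] [Ring E] [Algebra C E]
  [CommRing D] [Algebra C D] [Fintype ι] [DecidableEq ι] [Fintype κ] [DecidableEq κ]

/-- The Kronecker product of two matrix representations. -/
noncomputable def kroneckerRep (ρ : A →ₐ[C] Matrix ι ι D) (σ : E →ₐ[C] Matrix κ κ D) :
    A ⊗[C] E →ₐ[C] Matrix (ι × κ) (ι × κ) D :=
  (((Matrix.kroneckerAlgEquiv ι κ D).toAlgHom.restrictScalars C).comp
    (Algebra.TensorProduct.mapOfCompatibleSMul D C C _ _)).comp (Algebra.TensorProduct.map ρ σ)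

theorem kroneckerRep_tmul (ρ : A →ₐ[C] Matrix ι ι D) (σ : E →ₐ[C] Matrix κ κ D) (a : A) (x : E)
    (p q : ι × κ) : kroneckerRep ρ σ (a ⊗ₜ x) p q = ρ a p.1 q.1 * σ x p.2 q.2 := rfl

theorem isBaseChange_kroneckerRep {ρ : A →ₐ[C] Matrix ι ι D} {σ : E →ₐ[C] Matrix κ κ D}
    (hρ : IsBaseChange D ρ.toLinearMap) (hσ : IsBaseChange D σ.toLinearMap) :
    IsBaseChange D (kroneckerRep ρ σ).toLinearMap := by
  refine .of_equiv ((TensorProduct.AlgebraTensorModule.distribBaseChange C D A E).trans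
    ((TensorProduct.congr hρ.equiv hσ.equiv).trans (kroneckerLinearEquiv ι ι κ κ D)))
    fun z => ?_
  induction z with
  | zero => simp
  | add x y hx hy => rw [TensorProduct.tmul_add, map_add, hx, hy, map_add]
  | tmul a x =>
    ext p q
    simp [TensorProduct.AlgebraTensorModule.distribBaseChange, kroneckerRep_tmul,
      IsBaseChange.equiv_tmul]

end KroneckerRep

end Azumaya

/-! ### Tensor powers of `B` and their antisymmetrizers. -/

namespace Azumaya

section TensorPower

variable {C B : Type u} [CommRing C] [Ring B] [Algebra C B] [IsAzumaya C B]

/-- A model of the `m`-th tensor power of `B`, with its matrix representations over a splitting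
cover, its trace, the derivation `b ↦ ∑ᵢ 1 ⊗ ⋯ ⊗ b ⊗ ⋯ ⊗ 1`, and the antisymmetrizer of
the `m`-th tensor power of `e`, whose matrix entries are the minors of `e`. -/
structure TensorPower (S : EtaleSplitting C B) (e : B) (m : ℕ) where
  /-- The underlying type. -/
  carrier : Type u
  [ring : Ring carrier]
  [algebra : Algebra C carrier]
  [isAzumaya : IsAzumaya C carrier]
  brauerClass_eq : brauerClass C carrier = brauerClass C B ^ m
  /-- The matrix representations. -/
  rep (j : Fin S.r) :
    carrier →ₐ[C] Matrix (Fin m → Fin (S.n j)) (Fin m → Fin (S.n j)) (S.D j)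
  isBaseChange_rep (j : Fin S.r) : IsBaseChange (S.D j) (rep j).toLinearMap
  /-- The reduced trace. -/
  trace : carrier →ₗ[C] C
  trace_rep (j : Fin S.r) (x : carrier) : algebraMap C (S.D j) (trace x) = (rep j x).trace
  /-- The derivation. -/
  der : B →ₗ[C] carrier
  rep_der (j : Fin S.r) (b : B) (v : (Fin m → Fin (S.n j)) → S.D j) (f : Fin m → Fin (S.n j)) :
    (rep j (der b)).mulVec v f = ∑ i, ∑ c, S.rep j b (f i) c * v (Function.update f i c)
  /-- The antisymmetrizer. -/
  alt : carrier
  rep_alt (j : Fin S.r) (f h : Fin m → Fin (S.n j)) :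
    rep j alt f h = ((S.rep j e).submatrix f h).det

attribute [instance] TensorPower.ring TensorPower.algebra TensorPower.isAzumaya

theorem isBaseChange_ofId_matrix (C D ι : Type*) [CommRing C] [CommRing D] [Algebra C D]
    [Fintype ι] [DecidableEq ι] [Unique ι] :
    IsBaseChange D (Algebra.ofId C (Matrix ι ι D)).toLinearMap := by
  refine .of_equiv ((TensorProduct.AlgebraTensorModule.rid C D D).trans
    (((LinearEquiv.funUnique ι D D).symm.trans
      (LinearEquiv.funUnique ι D (ι → D)).symm).trans (Matrix.ofLinearEquiv D))) fun c => ?_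
  ext i j
  simp [Algebra.ofId_apply, Matrix.algebraMap_matrix_apply, Algebra.algebraMap_eq_smul_one,
    Subsingleton.elim i j]

/-- The zeroth tensor power. -/
noncomputable def TensorPower.zero (S : EtaleSplitting C B) (e : B) : TensorPower S e 0 where
  carrier := C
  brauerClass_eq := (pow_zero _).symm
  rep j := Algebra.ofId _ _
  isBaseChange_rep j := isBaseChange_ofId_matrix _ _ _
  trace := LinearMap.id
  trace_rep j x := by simp [Algebra.ofId_apply, Matrix.trace, Matrix.algebraMap_matrix_apply]
  der := 0
  rep_der j b v f := by simp
  alt := 1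
  rep_alt j f h := by simp [Subsingleton.elim f h]

namespace TensorPower

variable {S : EtaleSplitting C B} {e : B} {m : ℕ} (E : TensorPower S e m)

/-- The matrix representation of `B ⊗ E`, on the (`m + 1`)-st tensor power. -/
noncomputable def succRep (j : Fin S.r) : B ⊗[C] E.carrier →ₐ[C]
    Matrix (Fin (m + 1) → Fin (S.n j)) (Fin (m + 1) → Fin (S.n j)) (S.D j) :=
  ((Matrix.reindexAlgEquiv (S.D j) (S.D j)
    (Fin.consEquiv fun _ : Fin (m + 1) => Fin (S.n j))).toAlgHom.restrictScalars C).comp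
    (kroneckerRep (S.rep j) (E.rep j))

theorem succRep_tmul (j : Fin S.r) (b : B) (x : E.carrier) (f h : Fin (m + 1) → Fin (S.n j)) :
    E.succRep j (b ⊗ₜ x) f h =
      S.rep j b (f 0) (h 0) * E.rep j x (Fin.tail f) (Fin.tail h) := rfl

theorem isBaseChange_succRep (j : Fin S.r) : IsBaseChange (S.D j) (E.succRep j).toLinearMap :=
  .of_equiv ((isBaseChange_kroneckerRep (S.isBaseChange_rep j) (E.isBaseChange_rep j)).equiv.trans
    (Matrix.reindexLinearEquiv (S.D j) (S.D j)
      (Fin.consEquiv fun _ : Fin (m + 1) => Fin (S.n j))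
      (Fin.consEquiv fun _ : Fin (m + 1) => Fin (S.n j)))) fun x => by
    rw [LinearEquiv.trans_apply, IsBaseChange.equiv_tmul, one_smul]
    rfl

theorem succRep_tmul_mulVec (j : Fin S.r) (b : B) (x : E.carrier)
    (v : (Fin (m + 1) → Fin (S.n j)) → S.D j) (f : Fin (m + 1) → Fin (S.n j)) :
    (E.succRep j (b ⊗ₜ x)).mulVec v f =
      ∑ c, S.rep j b (f 0) c *
        (E.rep j x).mulVec (fun h => v (Fin.cons c h)) (Fin.tail f) := by
  rw [Matrix.mulVec, dotProduct,
    ← (Fin.consEquiv fun _ : Fin (m + 1) => Fin (S.n j)).sum_comp, Fintype.sum_prod_type]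
  refine Finset.sum_congr rfl fun c _ => ?_
  rw [Matrix.mulVec, dotProduct, Finset.mul_sum]
  refine Finset.sum_congr rfl fun h _ => ?_
  rw [← mul_assoc]
  rfl

theorem update_succ_eq_cons {α : Type*} (f : Fin (m + 1) → α) (i : Fin m) (c : α) :
    Function.update f i.succ c = Fin.cons (f 0) (Function.update (Fin.tail f) i c) := by
  rw [Fin.cons_update, Fin.cons_self_tail]

theorem update_zero_eq_cons {α : Type*} (f : Fin (m + 1) → α) (c : α) :
    Function.update f 0 c = Fin.cons c (Fin.tail f) := by
  rw [← Fin.cons_self_tail f, Fin.update_cons_zero, Fin.tail_cons]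

theorem succRep_der (j : Fin S.r) (b : B)
    (v : (Fin (m + 1) → Fin (S.n j)) → S.D j) (f : Fin (m + 1) → Fin (S.n j)) :
    (E.succRep j (b ⊗ₜ 1 + 1 ⊗ₜ E.der b)).mulVec v f =
      ∑ i, ∑ c, S.rep j b (f i) c * v (Function.update f i c) := by
  rw [map_add, Matrix.add_mulVec, Pi.add_apply, succRep_tmul_mulVec, succRep_tmul_mulVec,
    Fin.sum_univ_succ]
  congr 1
  · simp [update_zero_eq_cons]
  · simp only [E.rep_der, update_succ_eq_cons]
    simp [Matrix.one_apply, Fin.tail]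

/-- The Goldman element acts as a swap, and `E.der` spreads its second leg over the `m` factors of
`E`; the result is the sum of the transpositions of factor `0` with each other factor. -/
theorem succRep_sum_mulVec (j : Fin S.r) {k : ℕ} {a b : Fin k → B}
    (hab : ∀ i c i' c', ∑ l, S.rep j (a l) i c * S.rep j (b l) i' c' =
      if i = c' ∧ i' = c then 1 else 0)
    (v : (Fin (m + 1) → Fin (S.n j)) → S.D j) (f : Fin (m + 1) → Fin (S.n j)) :
    (E.succRep j (∑ l, a l ⊗ₜ E.der (b l))).mulVec v f =
      ∑ i, v (Fin.cons (f (Fin.succ i)) (Function.update (Fin.tail f) i (f 0))) := by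
  simp only [map_sum, Matrix.sum_mulVec, Finset.sum_apply, succRep_tmul_mulVec, E.rep_der]
  have h1 : ∀ l, ∑ c, S.rep j (a l) (f 0) c * ∑ i, ∑ c', S.rep j (b l) (Fin.tail f i) c' *
        v (Fin.cons c (Function.update (Fin.tail f) i c')) =
      ∑ i, ∑ c, ∑ c', (S.rep j (a l) (f 0) c * S.rep j (b l) (Fin.tail f i) c') *
        v (Fin.cons c (Function.update (Fin.tail f) i c')) := by
    intro l
    rw [Finset.sum_comm]
    simp only [Finset.mul_sum, mul_assoc]
  simp only [h1]
  rw [Finset.sum_comm]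
  refine Finset.sum_congr rfl fun i _ => ?_
  rw [Finset.sum_comm]
  have h2 : ∀ c, ∑ l, ∑ c', (S.rep j (a l) (f 0) c * S.rep j (b l) (Fin.tail f i) c') *
        v (Fin.cons c (Function.update (Fin.tail f) i c')) =
      ∑ c', (if f 0 = c' ∧ Fin.tail f i = c then 1 else 0) *
        v (Fin.cons c (Function.update (Fin.tail f) i c')) := by
    intro c
    rw [Finset.sum_comm]
    simp only [← Finset.sum_mul, hab]
  simp only [h2, ite_and, ite_mul, zero_mul, one_mul, Finset.sum_ite_eq, Finset.mem_univ, if_true]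
  rfl

/-- The next tensor power; it needs a presentation of the reduced trace of `B` by two-sided
multiplications, that is, the Goldman element of `B ⊗ B`. -/
noncomputable def succ {T : B →ₗ[C] C}
    (hT : ∀ j b, algebraMap C (S.D j) (T b) = (S.rep j b).trace) {k : ℕ} {a b : Fin k → B}
    (hab : ∀ x, ∑ l, a l * x * b l = algebraMap C B (T x)) : TensorPower S e (m + 1) :=
  have := isAzumaya_tensor (C := C) B E.carrier
  { carrier := B ⊗[C] E.carrier
    brauerClass_eq := by
      rw [pow_succ', ← E.brauerClass_eq]
      rfl
    rep := E.succRep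
    isBaseChange_rep := E.isBaseChange_succRep
    trace := (TensorProduct.lid C C).toLinearMap ∘ₗ TensorProduct.map T E.trace
    trace_rep := fun j x => by
      induction x with
      | zero => simp
      | add x y hx hy => rw [map_add, map_add, hx, hy, map_add, Matrix.trace_add]
      | tmul x y =>
        rw [Matrix.trace, ← (Fin.consEquiv fun _ : Fin (m + 1) => Fin (S.n j)).sum_comp,
          Fintype.sum_prod_type]
        simp [hT, E.trace_rep, Matrix.trace, Finset.sum_mul_sum]
        rfl
    der := (TensorProduct.mk C B E.carrier).flip 1 + TensorProduct.mk C B E.carrier 1 ∘ₗ E.der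
    rep_der := E.succRep_der
    -- The identity and the transpositions `(0 i)` represent the cosets of the stabiliser of `0`, so
    -- the signed sum over all permutations factors in this way; on entries it is
    -- `Matrix.det_submatrix_succ`.
    alt := (1 - ∑ l, a l ⊗ₜ E.der (b l)) * (e ⊗ₜ E.alt)
    rep_alt := fun j f h => by
      have h1 := E.succRep_sum_mulVec j (sum_mul_eq_ite (S.isBaseChange_rep j) (hT j) hab)
        (fun g => E.succRep j (e ⊗ₜ E.alt) g h) f
      rw [Matrix.det_submatrix_succ, sub_mul, one_mul, map_sub, map_mul, Matrix.sub_apply,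
        succRep_tmul, E.rep_alt]
      congr 1
      refine h1.trans (Finset.sum_congr rfl fun i _ => ?_)
      rw [succRep_tmul, E.rep_alt]
      rfl }

theorem exists_of_isUnit (S : EtaleSplitting C B) {e : B} {t : C} (ht : IsUnit t)
    (he : ∀ j, (S.rep j e).trace = algebraMap C (S.D j) t) (m : ℕ) :
    Nonempty (TensorPower S e m) := by
  obtain ⟨T, hT⟩ := S.exists_trace ht he
  obtain ⟨k, a, b, hab⟩ := exists_sum_mul_mul_eq T
  induction m with
  | zero => exact ⟨.zero S e⟩
  | succ m ih => exact ih.map fun E => E.succ hT hab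

end TensorPower

end TensorPower

end Azumaya

/-! ### Rank-one idempotents and the period. -/

/-- A square matrix whose `2 × 2` minors vanish satisfies `N X N = tr(N X) N`. -/
theorem Matrix.mul_mul_eq_trace_smul {D ι : Type*} [CommRing D] [Fintype ι] {N : Matrix ι ι D}
    (hN : ∀ f h f' h', N f h * N f' h' = N f h' * N f' h) (X : Matrix ι ι D) :
    N * X * N = (N * X).trace • N := by
  ext f h
  simp only [mul_apply, smul_apply, trace, diag_apply, smul_eq_mul, Finset.sum_mul]
  rw [Finset.sum_comm]
  conv_rhs => rw [Finset.sum_comm]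
  refine Finset.sum_congr rfl fun g _ => Finset.sum_congr rfl fun g' _ => ?_
  linear_combination X g g' * hN f g g' h

theorem prod_range_natCast_sub {R : Type*} [CommRing R] (d : ℕ) :
    ∏ i ∈ Finset.range d, ((d : R) - i) = (d.factorial : R) := by
  rw [← Finset.prod_range_add_one_eq_factorial, ← Finset.prod_range_reflect, Nat.cast_prod]
  refine Finset.prod_congr rfl fun i hi => ?_
  have := Finset.mem_range.1 hi
  rw [Nat.sub_sub, ← Nat.cast_sub (by lia)]
  congr 1
  lia

namespace Azumaya

section RankOne

variable {C E : Type u} [CommRing C] [Ring E] [Algebra C E]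

/-- An algebra containing a full idempotent `ε` with `ε E ε = C ε` is the endomorphism algebra of
the projective module `E ε`. -/
theorem brauerEquivalent_of_rankOne [Module.Finite C E] [Module.Projective C E] {T : E →ₗ[C] C}
    {ε : E} (hT : T ε = 1) (hε : ∀ x, ε * x * ε = T (ε * x) • ε) {k : ℕ} {a b : Fin k → E}
    (hab : ∑ l, a l * ε * b l = 1) : BrauerEquivalent C E C := by
  have hidem : ε * ε = ε := by simpa [hT] using hε 1
  let P : Submodule E E := Submodule.span E {ε}
  have hP : ∀ z : P, (z : E) * ε = z := by
    rintro ⟨z, hz⟩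
    obtain ⟨y, rfl⟩ := Submodule.mem_span_singleton.1 hz
    simp [mul_assoc, hidem]
  have hmem : ∀ y : E, y * ε ∈ P := fun y => Submodule.mem_span_singleton.2 ⟨y, rfl⟩
  let s : E →ₗ[C] P :=
    { toFun := fun y => ⟨y * ε, hmem y⟩
      map_add' := fun x y => Subtype.ext (add_mul x y ε)
      map_smul' := fun c y => Subtype.ext (smul_mul_assoc c y ε) }
  let i : P →ₗ[C] E := P.subtype.restrictScalars C
  have hsi : s ∘ₗ i = LinearMap.id := LinearMap.ext fun z => Subtype.ext (hP z)
  have hproj : Module.Projective C P := .of_split i s hsi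
  have hfin : Module.Finite C P :=
    .of_surjective s fun z => ⟨z, LinearMap.congr_fun hsi z⟩
  have hfaith : FaithfulSMul C P := by
    refine ⟨fun {x y} hxy => ?_⟩
    have h := congrArg (fun z : P => T z) (hxy (s 1))
    simpa [s, hT] using h
  let φ : E →ₐ[C] Module.End C P := Algebra.lsmul C C P
  have hφ : Function.Bijective φ := by
    -- Fullness gives injectivity: if `x` kills `E ε`, then `x = ∑ (x aₗ ε) bₗ = 0`.
    constructor
    · rw [injective_iff_map_eq_zero]
      intro x hx
      rw [← mul_one x, ← hab, Finset.mul_sum]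
      refine Finset.sum_eq_zero fun l _ => ?_
      have h : x * (a l * ε) = 0 := congrArg Subtype.val (LinearMap.congr_fun hx (s (a l)))
      rw [← mul_assoc, h, zero_mul]
    · intro f
      have key : ∀ (l : Fin k) (z : P), ε * b l * (z : E) = T (ε * (b l * z)) • ε := by
        intro l z
        rw [← hε, mul_assoc, mul_assoc, mul_assoc, hP]
      -- The elements `aₗ ε` generate `E ε`, with coordinates `z ↦ T (ε bₗ z)`, so `f` is determined
      -- by its values on them; the element given here acts on `E ε` by the same formula.
      refine ⟨∑ l, (f (s (a l)) : E) * b l, LinearMap.ext fun z => ?_⟩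
      have hz : z = ∑ l, T (ε * (b l * z)) • s (a l) := by
        apply Subtype.ext
        refine Eq.trans (b := ∑ l, a l * ε * b l * (z : E))
          (by rw [← Finset.sum_mul, hab, one_mul]) ?_
        rw [AddSubmonoidClass.coe_finsetSum]
        refine Finset.sum_congr rfl fun l _ => ?_
        rw [mul_assoc (a l), mul_assoc (a l), key, mul_smul_comm]
        rfl
      conv_rhs => rw [hz, map_sum]
      apply Subtype.ext
      rw [AddSubmonoidClass.coe_finsetSum]
      change (∑ l, (f (s (a l)) : E) * b l) * (z : E) = _
      rw [Finset.sum_mul]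
      refine Finset.sum_congr rfl fun l _ => ?_
      have h : (f (s (a l)) : E) * b l * z = T (ε * (b l * z)) • (f (s (a l)) : E) := by
        conv_lhs => rw [← hP (f (s (a l))), mul_assoc, mul_assoc, ← mul_assoc ε, key, mul_smul_comm, hP]
      rw [h, map_smul]
      rfl
  exact ⟨C, P, inferInstance, inferInstance, inferInstance, inferInstance,
    ⟨inferInstance, inferInstance, inferInstance⟩, ⟨hfin, hproj, hfaith⟩,
    ⟨(Algebra.TensorProduct.congr AlgEquiv.refl
        ((AlgEquiv.moduleEndSelf C).symm.trans (AlgEquiv.toOpposite C C).symm)).trans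
      ((Algebra.TensorProduct.rid C C _).trans ((AlgEquiv.ofBijective φ hφ).trans
        (Algebra.TensorProduct.lid C _).symm))⟩⟩

end RankOne

section Period

variable {C B : Type u} [CommRing C] [Algebra ℚ C] [Ring B] [Algebra C B] [IsAzumaya C B]

/-- An Azumaya algebra over a `ℚ`-algebra containing an idempotent of reduced trace `d > 0` has
period dividing `d`. -/
theorem brauerClass_pow_eq_one {e : B} (he : IsIdempotentElem e) {d : ℕ} (hd : d ≠ 0)
    (htr : IsReducedTrace e (d : C)) : brauerClass C B ^ d = 1 := by
  obtain ⟨S, hS⟩ := htr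
  have := S.faithfullyFlat
  have hunit : ∀ m : ℕ, m ≠ 0 → IsUnit (m : C) := fun m hm => by
    have := (IsUnit.mk0 (m : ℚ) (by exact_mod_cast hm)).map (algebraMap ℚ C)
    rwa [map_natCast] at this
  obtain ⟨E⟩ := TensorPower.exists_of_isUnit S (hunit d hd) hS d
  let _ : ∀ j, Algebra ℚ (S.D j) := fun j => ((algebraMap C (S.D j)).comp (algebraMap ℚ C)).toAlgebra
  have hidem : ∀ j, S.rep j e * S.rep j e = S.rep j e := fun j => by rw [← map_mul, he]
  have htrace : ∀ j, (S.rep j e).trace = (d : S.D j) := fun j => (hS j).trans (map_natCast _ _)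
  -- Over the cover this is the sum of the principal `d`-minors of an idempotent of trace `d`.
  have hT : E.trace E.alt = (d.factorial : C) := by
    apply algebraMap_pi_injective (D := S.D)
    ext j
    change algebraMap C (S.D j) _ = algebraMap C (S.D j) _
    rw [E.trace_rep, map_natCast, ← prod_range_natCast_sub, ← htrace,
      ← Matrix.sum_det_submatrix_self (hidem j)]
    exact Finset.sum_congr rfl fun f _ => E.rep_alt j f f
  -- The rank-one property holds over each member of the cover because the `2 × 2` minors of the
  -- matrix of `d`-minors vanish, and it descends.
  have hK : ∀ x, E.alt * x * E.alt = E.trace (E.alt * x) • E.alt := by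
    intro x
    rw [← sub_eq_zero]
    refine eq_zero_of_isBaseChange (D := S.D) E.isBaseChange_rep fun j => ?_
    rw [AlgHom.toLinearMap_apply, map_sub, map_smul, ← algebraMap_smul (S.D j), E.trace_rep,
      map_mul, map_mul, sub_eq_zero]
    refine Matrix.mul_mul_eq_trace_smul (fun f h f' h' => ?_) _
    simp only [E.rep_alt]
    exact Matrix.det_submatrix_mul_det_submatrix (hidem j) (htrace j) f h f' h'
  obtain ⟨w, hw⟩ := hunit _ d.factorial_ne_zero
  obtain ⟨k, a, b, hab⟩ := exists_sum_mul_mul_eq E.trace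
  -- The rank-one idempotent is `alt / d!`. It is full because the sandwich sum presenting the trace
  -- sends it to its trace, which is `1`.
  have h1 : E.trace ((↑w⁻¹ : C) • E.alt) = 1 := by
    rw [map_smul, hT, ← hw, smul_eq_mul, Units.inv_mul]
  rw [← E.brauerClass_eq]
  refine Quotient.sound (s := brauerSetoid C) (brauerEquivalent_of_rankOne h1 (fun x => ?_)
    (a := a) (b := b) ?_)
  · simp only [smul_mul_assoc, mul_smul_comm, hK, map_smul, smul_eq_mul, smul_smul]
    ring_nf
  · rw [hab, h1, map_one]

end Period

end Azumaya

theorem mainTheorem5 {C : Type u} [CommRing C] [Algebra ℂ C]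
    {B : Type u} [Ring B] [Algebra C B] [IsAzumaya C B]
    {k : ℕ} (d : Fin k → ℕ) (e : Fin k → B) (he : Azumaya.HasDimensionVector C d e) :
    Azumaya.period C B ∣ Finset.univ.gcd d ∧
      (Finset.univ.gcd d = 1 → Azumaya.brauerClass C B = 1) := by
  let _ : Algebra ℚ C := ((algebraMap ℂ C).comp (algebraMap ℚ ℂ)).toAlgebra
  have h : Azumaya.period C B ∣ Finset.univ.gcd d := by
    refine Finset.dvd_gcd fun i _ => ?_
    -- A zero entry imposes no condition, since everything divides `0`; the positive ones each bound
    -- the period.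
    by_cases hi : d i = 0
    · simp [hi]
    · exact orderOf_dvd_of_pow_eq_one
        (Azumaya.brauerClass_pow_eq_one (he.idempotents.idem i) hi (he.trace i))
  refine ⟨h, fun h1 => ?_⟩
  rw [h1, Nat.dvd_one] at h
  exact orderOf_eq_one_iff.1 h
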